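/- Let $R$ be a noetherian ring (associative, with $1$) with centre $Z(R)$, and let $C \subseteq Z(R)$ be a subring such that $R$ is a finitely generated $C$-module. For $A = C$ or $A = Z(R)$ (both are then commutative noetherian rings over which $R$ is a finitely generated module) and a maximal ideal $\mathfrak m$ of $A$, let $G_A(\mathfrak m, R)$ be the length of a maximal $A$-regular sequence in $\mathfrak m$ on the $A$-module $R$. The ring $R$ is called $A$-Macaulay if it is a maximal Cohen--Macaulay $A$-module, that is, if $$G_A(\mathfrak m,R) = \mathrm{Kdim}_{A_{\mathfrak m}}(R_{\mathfrak m}) = \mathrm{Kdim}(A_{\mathfrak m})$$ for every maximal ideal $\mathfrak m$ of $A$. (1) Suppose that $R$ is $Z(R)$-Macaulay. Then $R$ is $C$-Macaulay if and only if, for all maximal ideals $M$ and $N$ of $Z(R)$ with $M \cap C = N \cap C$, one has $\mathrm{ht}(M) = \mathrm{ht}(N)$. (2) Suppose that $Z(R)$ is equicodimensional, i.e. all maximal ideals of $Z(R)$ have the same height. Then $R$ is $Z(R)$-Macaulay if and only if $R$ is $C$-Macaulay. -/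

import Mathlib

namespace CentrallyMacaulay

/-- The grade `G_A(I, X)`: the supremum of the lengths of the `A`-regular sequences on `X` whose
terms lie in `I`. If `A` is noetherian, `X` is finitely generated and `I X ≠ X`, this is the
common length of all maximal regular sequences on `X` in `I`. -/
noncomputable def idealGrade (A : Type*) [CommRing A] (I : Ideal A) (X : Type*) [AddCommGroup X]
    [Module A X] : ℕ∞ :=
  ⨆ (xs : List A) (_ : ∀ x ∈ xs, x ∈ I) (_ : RingTheory.Sequence.IsRegular X xs),
    (xs.length : ℕ∞)

/-- `X` is a Cohen-Macaulay `A`-module: at every maximal ideal `m` of `A`, the grade of `m` on `X`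
is the Krull dimension of the `A_m`-module `X_m`. -/
def IsCohenMacaulayModule (A : Type*) [CommRing A] (X : Type*) [AddCommGroup X]
    [Module A X] : Prop :=
  ∀ (m : Ideal A) [m.IsMaximal],
    (idealGrade A m X : WithBot ℕ∞) =
      Module.supportDim (Localization.AtPrime m) (LocalizedModule.AtPrime m X)

/-- `X` is a maximal Cohen-Macaulay `A`-module: it is Cohen-Macaulay, and at every maximal ideal
`m` of `A` the grade of `m` on `X` is the Krull dimension of the local ring `A_m`. -/
def IsMaximalCohenMacaulayModule (A : Type*) [CommRing A] (X : Type*) [AddCommGroup X]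
    [Module A X] : Prop :=
  IsCohenMacaulayModule A X ∧
    ∀ (m : Ideal A) [m.IsMaximal],
      (idealGrade A m X : WithBot ℕ∞) = ringKrullDim (Localization.AtPrime m)

/-- The ring `R` is `C`-Macaulay, where `C` acts on `R` (in the intended use: `C` is a central
subring of `R` over which `R` is a finite module, or the centre of `R` itself). -/
def IsMacaulayOver (C R : Type*) [CommRing C] [Ring R] [Module C R] : Prop :=
  IsMaximalCohenMacaulayModule C R

/-- A commutative ring is equicodimensional if all its maximal ideals have the same height. -/
def IsEquicodimensional (A : Type*) [CommRing A] : Prop :=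
  ∀ M N : Ideal A, M.IsMaximal → N.IsMaximal → M.height = N.height

end CentrallyMacaulay

/-!
A maximal ideal `m` of `A` has maximal ideals `M` of the finite extension `B` above it, and the
grade and height of `m` on `X` are compared with those of the `M`s.

*Height.* Incomparability gives `ht M ≤ ht m`, and going up gives equality for at least one `M`.

*Grade.* A regular sequence in `m` is one in every `M`, so `G_A(m, X) ≤ G_B(M, X)`. Conversely,
`G_A(m, X)` is at least the minimum of the `G_B(M, X)`: if that minimum is positive, no associated
prime of the `B`-module `X` lies over `m`, and prime avoidance yields an `X`-regular `x ∈ m`; by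
Rees' theorem passing to `X / xX` lowers every `G_B(M, X)` by one, and one proceeds by induction.

Since grade never exceeds height, `G_A(m, X) = ht m` squeezes
`ht M ≤ ht m = G_A(m, X) ≤ G_B(M, X) ≤ ht M`; and if `G_B(M, X) = ht M` is the same number for all
`M` above `m`, that number is `ht m` and bounds `G_A(m, X)` from below.

That the base ring is noetherian when `R` is comes from Formanek's form of the Eakin–Nagata theorem.
-/

namespace CentrallyMacaulay

open Pointwise RingTheory.Sequence CategoryTheory Abelian

section EakinNagata

variable {A Y : Type*} [CommRing A] [AddCommGroup Y] [Module A Y]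

theorem mem_annihilator_quotient_iff_smul_top_le {N : Submodule A Y} {c : A} :
    c ∈ Module.annihilator A (Y ⧸ N) ↔ c • (⊤ : Submodule A Y) ≤ N := by
  rw [Submodule.annihilator_quotient, Submodule.mem_colon]
  exact ⟨by rintro h _ ⟨y, -, rfl⟩; exact h y trivial,
    fun h y _ ↦ h (Submodule.smul_mem_pointwise_smul y c ⊤ trivial)⟩

theorem fg_smul_top [Module.Finite A Y] (c : A) : (c • (⊤ : Submodule A Y)).FG :=
  Module.Finite.fg_top.map _

-- Formanek's device: with `Y` replaced by such a quotient, every nonzero submodule contains some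
-- `c Y` with `c` outside the annihilator.
theorem exists_maximal_annihilator_quotient_le [Module.Finite A Y] :
    ∃ N : Submodule A Y,
      Maximal (fun N ↦ Module.annihilator A (Y ⧸ N) ≤ Module.annihilator A Y) N := by
  have sSup_mem : ∀ K ⊆ {N : Submodule A Y | Module.annihilator A (Y ⧸ N) ≤ Module.annihilator A Y},
      IsChain (· ≤ ·) K → K.Nonempty →
        Module.annihilator A (Y ⧸ sSup K) ≤ Module.annihilator A Y := by
    intro K hK hchain hne c hc
    obtain ⟨N, hNK, hcN⟩ := (CompleteLattice.isCompactElement_iff_le_of_directed_sSup_le _ _).1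
      ((Submodule.fg_iff_compact _).1 (fg_smul_top c)) K hne hchain.directedOn
      (mem_annihilator_quotient_iff_smul_top_le.1 hc)
    exact hK hNK (mem_annihilator_quotient_iff_smul_top_le.2 hcN)
  obtain ⟨N, -, hN⟩ := zorn_le_nonempty₀ _
    (fun K hK hchain N hN ↦ ⟨sSup K, sSup_mem K hK hchain ⟨N, hN⟩, fun _ ↦ le_sSup⟩) ⊥
    (Submodule.quotEquivOfEqBot (⊥ : Submodule A Y) rfl).annihilator_eq.le
  exact ⟨N, hN⟩

theorem isNoetherian_quotient_of_maximal_annihilator_quotient_le [Module.Finite A Y]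
    (h : ∀ c ∉ Module.annihilator A Y, IsNoetherian A (QuotSMulTop c Y)) {N : Submodule A Y}
    (hN : Maximal (fun N ↦ Module.annihilator A (Y ⧸ N) ≤ Module.annihilator A Y) N) :
    IsNoetherian A (Y ⧸ N) := by
  have fg_of_lt : ∀ P, N < P → P.FG := by
    intro P hNP
    obtain ⟨c, hcP, hc⟩ := SetLike.not_le_iff_exists.1 fun hP ↦ hN.not_prop_of_gt hNP hP
    have := h c hc
    refine Submodule.fg_of_fg_map_of_fg_inf_ker (c • (⊤ : Submodule A Y)).mkQ
      (IsNoetherian.noetherian (M := QuotSMulTop c Y) _) ?_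
    rw [Submodule.ker_mkQ, inf_eq_right.2 (mem_annihilator_quotient_iff_smul_top_le.1 hcP)]
    exact fg_smul_top c
  refine ⟨fun P ↦ ?_⟩
  rcases (N.le_comap_mkQ P).eq_or_lt with hP | hP
  · rw [← Submodule.map_comap_eq_of_surjective N.mkQ_surjective P, ← hP, N.mkQ_map_self]
    exact Submodule.fg_bot
  · rw [← Submodule.map_comap_eq_of_surjective N.mkQ_surjective P]
    exact (fg_of_lt _ hP).map N.mkQ

theorem isNoetherian_quotient_annihilator [IsNoetherian A Y] :
    IsNoetherian A (A ⧸ Module.annihilator A Y) := by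
  have hker : LinearMap.ker (LinearMap.lsmul A Y) = Module.annihilator A Y := by
    ext c
    simp [Module.mem_annihilator, LinearMap.ext_iff]
  rw [← hker]
  exact isNoetherian_of_linearEquiv (LinearMap.lsmul A Y).quotKerEquivRange.symm

theorem isNoetherian_of_isNoetherian_quotient_annihilator [Module.Finite A Y]
    [IsNoetherian A (A ⧸ Module.annihilator A Y)] : IsNoetherian A Y := by
  let _ : Module (A ⧸ Module.annihilator A Y) Y := Module.quotientAnnihilator
  have torsion := Module.isTorsionBySet_annihilator A Y
  have : IsScalarTower A (A ⧸ Module.annihilator A Y) Y := torsion.isScalarTower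
  have : IsNoetherianRing (A ⧸ Module.annihilator A Y) := isNoetherian_of_tower A inferInstance
  have : Module.Finite (A ⧸ Module.annihilator A Y) Y := .of_restrictScalars_finite A _ Y
  exact (torsion.semilinearMap.isNoetherian_iff_of_bijective Function.bijective_id).2 inferInstance

theorem isNoetherian_of_forall_isNoetherian_quotSMulTop [Module.Finite A Y]
    (h : ∀ c ∉ Module.annihilator A Y, IsNoetherian A (QuotSMulTop c Y)) : IsNoetherian A Y := by
  obtain ⟨N, hN⟩ := exists_maximal_annihilator_quotient_le (A := A) (Y := Y)
  have := isNoetherian_quotient_of_maximal_annihilator_quotient_le h hN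
  have hann : Module.annihilator A (Y ⧸ N) = Module.annihilator A Y :=
    hN.prop.antisymm (LinearMap.annihilator_le_of_surjective N.mkQ N.mkQ_surjective)
  have : IsNoetherian A (A ⧸ Module.annihilator A Y) := hann ▸ isNoetherian_quotient_annihilator
  exact isNoetherian_of_isNoetherian_quotient_annihilator

theorem isNoetherian_of_isNoetherian_of_finite (R : Type*) [Ring R] [Algebra A R] [Module R Y]
    [IsScalarTower A R Y] [IsNoetherian R Y] [Module.Finite A Y] : IsNoetherian A Y := by
  suffices h : ∀ L : Submodule R Y, IsNoetherian A (Y ⧸ L) by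
    have := h ⊥
    exact isNoetherian_of_linearEquiv
      ((Submodule.quotEquivOfEqBot (⊥ : Submodule R Y) rfl).restrictScalars A)
  refine fun L ↦ IsNoetherian.induction (P := fun L : Submodule R Y ↦ IsNoetherian A (Y ⧸ L))
    (fun L ih ↦ ?_) L
  have : Module.Finite A (Y ⧸ L) :=
    Module.Finite.of_surjective (L.mkQ.restrictScalars A) L.mkQ_surjective
  refine isNoetherian_of_forall_isNoetherian_quotSMulTop fun c hc ↦ ?_
  let cQ : Submodule R (Y ⧸ L) := c • ⊤
  have hlt : L < cQ.comap L.mkQ := by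
    refine (L.le_comap_mkQ cQ).lt_of_not_ge fun hle ↦ hc (Module.mem_annihilator.2 fun z ↦ ?_)
    obtain ⟨y, rfl⟩ := L.mkQ_surjective z
    exact (Submodule.Quotient.mk_eq_zero L).2
      (hle (Submodule.smul_mem_pointwise_smul (L.mkQ y) c ⊤ trivial))
  have := ih _ hlt
  let f : Y ⧸ cQ.comap L.mkQ →ₗ[R] (Y ⧸ L) ⧸ cQ := Submodule.mapQ _ cQ L.mkQ le_rfl
  have hf : Function.Surjective f := LinearMap.range_eq_top.1 (by simp [f, Submodule.range_mapQ])
  have := isNoetherian_of_surjective (f.restrictScalars A) (LinearMap.range_eq_top.2 hf)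
  exact isNoetherian_of_linearEquiv (Submodule.Quotient.restrictScalarsEquiv A cQ).symm

end EakinNagata

section Height

variable {A B : Type*} [CommRing A] [CommRing B] [Algebra A B] [Algebra.IsIntegral A B]

theorem height_le_height_comap (M : Ideal B) [hM : M.IsPrime] :
    M.height ≤ (M.comap (algebraMap A B)).height := by
  have hmono : StrictMono (PrimeSpectrum.comap (algebraMap A B)) := fun _ _ hPQ ↦
    Ideal.IsIntegral.comap_lt_comap (R := A) hPQ
  have := Order.height_le_height_apply_of_strictMono _ hmono ⟨M, hM⟩
  rwa [← PrimeSpectrum.height_eq_orderHeight, ← PrimeSpectrum.height_eq_orderHeight] at this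

theorem exists_comap_eq_and_height_le_height [FaithfulSMul A B] (p : Ideal A) [hp : p.IsPrime]
    [p.FiniteHeight] :
    ∃ P : Ideal B, P.IsPrime ∧ P.comap (algebraMap A B) = p ∧ p.height ≤ P.height := by
  obtain ⟨l, hl, hlen⟩ := p.exists_ltSeries_length_eq_height
  obtain ⟨Q, hQ, hQl⟩ := (Ideal.nonempty_primesOver (S := B) l.head.asIdeal).some
  obtain ⟨L, hLlen, -, hL⟩ := Ideal.exists_ltSeries_of_hasGoingUp l Q
  have hlast : PrimeSpectrum.comap (algebraMap A B) L.last = l.last := by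
    have hne : L.toList.map (PrimeSpectrum.comap (algebraMap A B)) ≠ [] := by
      simpa using L.toList_ne_nil
    rw [← L.getLast_toList, ← l.getLast_toList, ← List.getLast_map hne]
    simp only [hL]
  refine ⟨L.last.asIdeal, L.last.isPrime, congrArg PrimeSpectrum.asIdeal (hlast.trans hl), ?_⟩
  rw [PrimeSpectrum.height_eq_orderHeight, ← hlen, ← hLlen]
  exact Order.length_le_height_last

theorem exists_isMaximal_comap_eq_and_height_eq [FaithfulSMul A B] (m : Ideal A) [hm : m.IsMaximal]
    [m.FiniteHeight] :
    ∃ M : Ideal B, M.IsMaximal ∧ M.comap (algebraMap A B) = m ∧ M.height = m.height := by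
  obtain ⟨M, hM, rfl, hle⟩ := exists_comap_eq_and_height_le_height (B := B) m
  exact ⟨M, Ideal.isMaximal_of_isIntegral_of_isMaximal_comap M hm, rfl,
    (height_le_height_comap M).antisymm hle⟩

end Height

section RegularSequence

variable {A B X : Type*} [CommRing A] [CommRing B] [Algebra A B] [AddCommGroup X] [Module A X]
  [Module B X] [IsScalarTower A B X]

theorem isRegular_take {xs : List A} (hxs : IsRegular X xs) (n : ℕ) : IsRegular X (xs.take n) := by
  have hprefix := hxs.toIsWeaklyRegular
  rw [← List.take_append_drop n xs, isWeaklyRegular_append_iff] at hprefix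
  refine ⟨hprefix.1, fun htop ↦ hxs.top_ne_smul (top_le_iff.1 ?_).symm⟩
  calc ⊤ = Ideal.ofList (xs.take n) • (⊤ : Submodule A X) := htop
    _ ≤ Ideal.ofList xs • ⊤ :=
      Submodule.smul_mono_left (Ideal.span_mono fun _ ↦ List.mem_of_mem_take)

theorem isRegular_of_isWeaklyRegular_of_mem {I : Ideal A} (hI : I • (⊤ : Submodule A X) ≠ ⊤)
    {xs : List A} (hmem : ∀ x ∈ xs, x ∈ I) (hxs : IsWeaklyRegular X xs) : IsRegular X xs :=
  ⟨hxs, fun htop ↦ hI (top_le_iff.1 (htop.le.trans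
    (Submodule.smul_mono_left (Ideal.span_le.2 hmem))))⟩

theorem isRegular_map_algebraMap_iff (xs : List A) :
    IsRegular X (xs.map (algebraMap A B)) ↔ IsRegular X xs := by
  rw [isRegular_iff, isRegular_iff, isWeaklyRegular_map_algebraMap_iff, ← Ideal.map_ofList]
  refine and_congr_right' (not_congr ?_)
  rw [← Submodule.restrictScalars_inj A, Ideal.smul_restrictScalars, Submodule.restrictScalars_top]

theorem smul_top_ne_top_of_finite [Module.Finite A X] [FaithfulSMul A X] {I : Ideal A}
    (hI : I ≠ ⊤) : I • (⊤ : Submodule A X) ≠ ⊤ := by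
  intro htop
  obtain ⟨r, hrI, hr⟩ := Submodule.exists_sub_one_mem_and_smul_eq_zero_of_fg_of_le_smul
    I (⊤ : Submodule A X) Module.Finite.fg_top htop.ge
  have hr0 : r = 0 := by
    rw [← Ideal.mem_bot, ← Module.annihilator_eq_bot.2 ‹_›, Module.mem_annihilator]
    exact fun x ↦ hr x trivial
  rw [hr0, zero_sub, neg_mem_iff] at hrI
  exact hI ((Ideal.eq_top_iff_one I).2 hrI)

theorem smul_top_quotSMulTop_ne_top {I : Ideal A} (hI : I • (⊤ : Submodule A X) ≠ ⊤) {x : A}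
    (hx : x ∈ I) : I • (⊤ : Submodule A (QuotSMulTop x X)) ≠ ⊤ := by
  intro htop
  have hcomap := congrArg (Submodule.comap (x • (⊤ : Submodule A X)).mkQ) htop
  rw [Submodule.comap_smul_top_of_surjective I _ (Submodule.mkQ_surjective _), Submodule.ker_mkQ,
    Submodule.comap_top, ← Submodule.ideal_span_singleton_smul, sup_eq_left.2
      (Submodule.smul_mono_left ((Ideal.span_singleton_le_iff_mem I).2 hx))] at hcomap
  exact hI hcomap

end RegularSequence

section Grade

variable {A B X : Type*} [CommRing A] [CommRing B] [Algebra A B] [AddCommGroup X] [Module A X]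
  [Module B X] [IsScalarTower A B X]

theorem length_le_idealGrade {I : Ideal A} {xs : List A} (hmem : ∀ x ∈ xs, x ∈ I)
    (hxs : IsRegular X xs) : xs.length ≤ idealGrade A I X :=
  le_iSup_of_le xs (le_iSup_of_le hmem (le_iSup_of_le hxs le_rfl))

theorem natCast_le_idealGrade_iff [Nontrivial X] {I : Ideal A} {n : ℕ} :
    n ≤ idealGrade A I X ↔
      ∃ xs : List A, xs.length = n ∧ (∀ x ∈ xs, x ∈ I) ∧ IsRegular X xs := by
  refine ⟨fun h ↦ ?_, fun ⟨xs, hlen, hmem, hxs⟩ ↦ hlen ▸ length_le_idealGrade hmem hxs⟩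
  obtain _ | n := n
  · exact ⟨[], rfl, by simp, .nil A X⟩
  · have hlt : (n : ℕ∞) < idealGrade A I X := (Nat.cast_lt.2 n.lt_succ_self).trans_le h
    simp only [idealGrade, lt_iSup_iff, Nat.cast_lt] at hlt
    obtain ⟨xs, hmem, hxs, hlen⟩ := hlt
    exact ⟨xs.take (n + 1), List.length_take_of_le hlen,
      fun x hx ↦ hmem x (List.mem_of_mem_take hx), isRegular_take hxs _⟩

theorem idealGrade_comap_le (M : Ideal B) :
    idealGrade A (M.comap (algebraMap A B)) X ≤ idealGrade B M X := by
  refine iSup_le fun xs ↦ iSup₂_le fun hmem hxs ↦ ?_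
  rw [← List.length_map (algebraMap A B)]
  exact length_le_idealGrade (by simpa using hmem) ((isRegular_map_algebraMap_iff xs).2 hxs)

end Grade

section Rees

universe u v

variable {A : Type u} {X : Type v} [CommRing A] [Small.{v} A] [IsNoetherianRing A] [AddCommGroup X]
  [Module A X] [Module.Finite A X] {I : Ideal A} {n : ℕ}

theorem natCast_le_idealGrade_iff_subsingleton_ext (hI : I • (⊤ : Submodule A X) ≠ ⊤) :
    n ≤ idealGrade A I X ↔ ∀ i < n,
      Subsingleton (Ext (ModuleCat.of A (Shrink.{v} (A ⧸ I))) (ModuleCat.of A X) i) := by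
  have : Nontrivial X := (Submodule.nontrivial_iff A).1 (nontrivial_of_ne _ _ hI)
  rw [natCast_le_idealGrade_iff]
  exact ((ModuleCat.exists_isRegular_tfae I n (ModuleCat.of A X) hI.lt_top).out 1 3).symm

theorem natCast_le_idealGrade_quotSMulTop (hI : I • (⊤ : Submodule A X) ≠ ⊤)
    (h : (n + 1 : ℕ) ≤ idealGrade A I X) {x : A} (hxI : x ∈ I) (hx : IsSMulRegular X x) :
    n ≤ idealGrade A I (QuotSMulTop x X) := by
  rw [natCast_le_idealGrade_iff_subsingleton_ext hI] at h
  rw [natCast_le_idealGrade_iff_subsingleton_ext (smul_top_quotSMulTop_ne_top hI hxI)]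
  intro i hi
  have hx : IsSMulRegular (ModuleCat.of A X) x := hx
  have ext_i := AddCommGrpCat.isZero_of_iff_subsingleton.2 (h i (by lia))
  have ext_succ := AddCommGrpCat.isZero_of_iff_subsingleton.2 (h (i + 1) (by lia))
  exact AddCommGrpCat.subsingleton_of_isZero <| ShortComplex.Exact.isZero_of_both_zeros
    (Ext.covariant_sequence_exact₃' _ hx.smulShortComplex_shortExact i (i + 1) rfl)
    (ext_i.eq_zero_of_src _) (ext_succ.eq_zero_of_tgt _)

end Rees

section Descent

universe v

variable {A B : Type*} {X : Type v} [CommRing A] [CommRing B] [Algebra A B] [AddCommGroup X]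
  [Module B X]

theorem exists_mem_isSMulRegular_algebraMap [IsNoetherianRing B] [Module.Finite B X] {I : Ideal A}
    (h : ∀ P ∈ associatedPrimes B X, ¬ I ≤ P.comap (algebraMap A B)) :
    ∃ x ∈ I, IsSMulRegular X (algebraMap A B x) := by
  by_contra! hzero
  have hunion : (I : Set A) ⊆
      ⋃ P ∈ associatedPrimes B X, (P.comap (algebraMap A B) : Set A) := by
    intro x hx
    have : algebraMap A B x ∈ ⋃ P ∈ associatedPrimes B X, (P : Set B) := by
      rw [biUnion_associatedPrimes_eq_compl_regular]
      exact hzero x hx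
    simpa using this
  obtain ⟨P, hP, hIP⟩ := (Ideal.subset_union_prime_finite (associatedPrimes.finite B X)
    (f := fun P ↦ P.comap (algebraMap A B)) ⊥ ⊥
    fun P hP _ _ ↦ hP.isPrime.comap (algebraMap A B)).1 hunion
  exact h P hP hIP

theorem exists_mem_isSMulRegular_of_one_le_idealGrade {I : Ideal B} (h : 1 ≤ idealGrade B I X) :
    ∃ x ∈ I, IsSMulRegular X x := by
  have hlt : (0 : ℕ∞) < idealGrade B I X := zero_lt_one.trans_le h
  simp only [idealGrade, lt_iSup_iff] at hlt
  obtain ⟨xs, hmem, hxs, hlen⟩ := hlt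
  obtain _ | ⟨x, xs⟩ := xs
  · simp at hlen
  · exact ⟨x, hmem x List.mem_cons_self, ((isRegular_cons_iff X x xs).1 hxs).1⟩

theorem exists_mem_isSMulRegular_of_one_le_idealGrade_of_comap_eq [Algebra.IsIntegral A B]
    [IsNoetherianRing B] [Module.Finite B X] (m : Ideal A) [hm : m.IsMaximal]
    (h : ∀ M : Ideal B, M.IsMaximal → M.comap (algebraMap A B) = m → 1 ≤ idealGrade B M X) :
    ∃ x ∈ m, IsSMulRegular X (algebraMap A B x) := by
  refine exists_mem_isSMulRegular_algebraMap fun P hP hmP ↦ ?_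
  have : P.IsPrime := hP.isPrime
  have hPm : P.comap (algebraMap A B) = m :=
    (hm.eq_of_le (Ideal.IsPrime.ne_top inferInstance) hmP).symm
  have hPmax : P.IsMaximal := Ideal.isMaximal_of_isIntegral_of_isMaximal_comap P (hPm ▸ hm)
  obtain ⟨b, hbP, hb⟩ := exists_mem_isSMulRegular_of_one_le_idealGrade (h P hPmax hPm)
  have : b ∈ ⋃ P ∈ associatedPrimes B X, (P : Set B) := Set.mem_biUnion hP hbP
  rw [biUnion_associatedPrimes_eq_compl_regular] at this
  exact this hb

theorem exists_isWeaklyRegular_map_of_natCast_le_idealGrade [Algebra.IsIntegral A B]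
    [IsNoetherianRing B] [Small.{v} B] [Module.Finite B X] (m : Ideal A) [m.IsMaximal]
    (htop : ∀ M : Ideal B, M.IsMaximal → M.comap (algebraMap A B) = m →
      M • (⊤ : Submodule B X) ≠ ⊤) (n : ℕ)
    (h : ∀ M : Ideal B, M.IsMaximal → M.comap (algebraMap A B) = m → n ≤ idealGrade B M X) :
    ∃ xs : List A, xs.length = n ∧ (∀ x ∈ xs, x ∈ m) ∧
      IsWeaklyRegular X (xs.map (algebraMap A B)) := by
  induction n generalizing X with
  | zero => exact ⟨[], rfl, by simp, .nil B X⟩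
  | succ n ih =>
    obtain ⟨x, hxm, hx⟩ := exists_mem_isSMulRegular_of_one_le_idealGrade_of_comap_eq (X := X) m
      fun M hM hMm ↦ le_trans (by simp) (h M hM hMm)
    have hxM : ∀ M : Ideal B, M.comap (algebraMap A B) = m → algebraMap A B x ∈ M := by
      rintro M rfl
      exact hxm
    obtain ⟨xs, hlen, hmem, hxs⟩ := ih (X := QuotSMulTop (algebraMap A B x) X)
      (fun M hM hMm ↦ smul_top_quotSMulTop_ne_top (htop M hM hMm) (hxM M hMm))
      (fun M hM hMm ↦ natCast_le_idealGrade_quotSMulTop (htop M hM hMm) (h M hM hMm) (hxM M hMm) hx)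
    exact ⟨x :: xs, by simp [hlen], List.forall_mem_cons.2 ⟨hxm, hmem⟩, .cons hx hxs⟩

theorem natCast_le_idealGrade_of_forall_comap_eq [Algebra.IsIntegral A B] [IsNoetherianRing B]
    [Module.Finite B X] [FaithfulSMul B X] [Module A X] [IsScalarTower A B X] {m : Ideal A}
    [m.IsMaximal] (hmX : m • (⊤ : Submodule A X) ≠ ⊤) {n : ℕ}
    (h : ∀ M : Ideal B, M.IsMaximal → M.comap (algebraMap A B) = m → n ≤ idealGrade B M X) :
    n ≤ idealGrade A m X := by
  have : Small.{v} B := small_of_injective (smul_left_injective' (M := B) (α := X))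
  obtain ⟨xs, rfl, hmem, hxs⟩ := exists_isWeaklyRegular_map_of_natCast_le_idealGrade m
    (fun M hM _ ↦ smul_top_ne_top_of_finite hM.ne_top) n h
  exact length_le_idealGrade hmem <| isRegular_of_isWeaklyRegular_of_mem hmX hmem
    ((isWeaklyRegular_map_algebraMap_iff B X xs).1 hxs)

end Descent

section MaximalCohenMacaulay

variable {A X : Type*} [CommRing A] [AddCommGroup X] [Module A X] [Module.Finite A X]

theorem mem_support_of_faithfulSMul [FaithfulSMul A X] (p : PrimeSpectrum A) :
    p ∈ Module.support A X := by
  rw [Module.mem_support_iff_of_finite, Module.annihilator_eq_bot.2 ‹_›]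
  exact bot_le

variable [IsNoetherianRing A]

theorem length_le_supportDim_of_isRegular [IsLocalRing A] {xs : List A} (hxs : IsRegular X xs) :
    (xs.length : WithBot ℕ∞) ≤ Module.supportDim A X := by
  rw [← Module.supportDim_add_length_eq_supportDim_of_isRegular xs hxs]
  have : Nontrivial (X ⧸ Ideal.ofList xs • (⊤ : Submodule A X)) := hxs.quot_ofList_smul_nontrivial ⊤
  have := (Module.nonempty_support_of_nontrivial (R := A)
    (M := X ⧸ Ideal.ofList xs • (⊤ : Submodule A X))).to_subtype
  exact le_add_of_nonneg_left Order.krullDim_nonneg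

theorem idealGrade_le_supportDim (p : Ideal A) [hp : p.IsPrime]
    (hsupp : ⟨p, hp⟩ ∈ Module.support A X) :
    (idealGrade A p X : WithBot ℕ∞) ≤
      Module.supportDim (Localization.AtPrime p) (LocalizedModule.AtPrime p X) := by
  have : Nontrivial (LocalizedModule.AtPrime p X) := hsupp
  obtain ⟨d, hd⟩ := WithBot.ne_bot_iff_exists.1 (Module.supportDim_ne_bot_of_nontrivial
    (Localization.AtPrime p) (LocalizedModule.AtPrime p X))
  rw [← hd, WithBot.coe_le_coe]
  refine iSup_le fun xs ↦ iSup₂_le fun hmem hxs ↦ ?_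
  have hloc := hxs.1.isRegular_of_isLocalizedModule_of_mem (Localization.AtPrime p) p
    (LocalizedModule.mkLinearMap p.primeCompl X) hmem
  rw [← WithBot.coe_le_coe, hd, ← List.length_map (algebraMap A (Localization.AtPrime p))]
  exact length_le_supportDim_of_isRegular hloc

theorem idealGrade_le_height [FaithfulSMul A X] (p : Ideal A) [p.IsPrime] :
    idealGrade A p X ≤ p.height := by
  rw [← WithBot.coe_le_coe,
    ← IsLocalization.AtPrime.ringKrullDim_eq_height p (Localization.AtPrime p)]
  exact (idealGrade_le_supportDim p (mem_support_of_faithfulSMul _)).trans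
    (Module.supportDim_le_ringKrullDim _ _)

theorem isMaximalCohenMacaulayModule_iff_forall_idealGrade_eq_height [FaithfulSMul A X] :
    IsMaximalCohenMacaulayModule A X ↔
      ∀ m : Ideal A, m.IsMaximal → idealGrade A m X = m.height := by
  have height_iff (m : Ideal A) [m.IsMaximal] :
      (idealGrade A m X : WithBot ℕ∞) = ringKrullDim (Localization.AtPrime m) ↔
        idealGrade A m X = m.height := by
    rw [IsLocalization.AtPrime.ringKrullDim_eq_height m, WithBot.coe_inj]
  refine ⟨fun h m hm ↦ (height_iff m).1 (h.2 m), fun h ↦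
    ⟨fun m hm ↦ ?_, fun m hm ↦ (height_iff m).2 (h m hm)⟩⟩
  refine (idealGrade_le_supportDim m (mem_support_of_faithfulSMul _)).antisymm ?_
  rw [(height_iff m).2 (h m hm)]
  exact Module.supportDim_le_ringKrullDim _ _

end MaximalCohenMacaulay

section FiniteExtension

variable {A B X : Type*} [CommRing A] [CommRing B] [Algebra A B] [AddCommGroup X] [Module A X]
  [Module B X] [IsScalarTower A B X] [FaithfulSMul B X]

variable (A B X) in
theorem faithfulSMul_trans [FaithfulSMul A B] : FaithfulSMul A X :=
  ⟨fun h ↦ FaithfulSMul.algebraMap_injective A B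
    (FaithfulSMul.eq_of_smul_eq_smul (α := X) fun x ↦ by simpa only [algebraMap_smul] using h x)⟩

variable [IsNoetherianRing A] [Module.Finite A B] [Module.Finite B X]

theorem idealGrade_eq_height_of_idealGrade_comap_eq_height {M : Ideal B} [M.IsPrime]
    (h : idealGrade A (M.comap (algebraMap A B)) X = (M.comap (algebraMap A B)).height) :
    idealGrade B M X = M.height ∧ M.height = (M.comap (algebraMap A B)).height := by
  have : IsNoetherianRing B := isNoetherian_of_tower A inferInstance
  have grade_le : idealGrade B M X ≤ M.height := idealGrade_le_height M
  have height_le : M.height ≤ (M.comap (algebraMap A B)).height := height_le_height_comap M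
  have le_grade : (M.comap (algebraMap A B)).height ≤ idealGrade B M X := h ▸ idealGrade_comap_le M
  exact ⟨grade_le.antisymm (height_le.trans le_grade), height_le.antisymm (le_grade.trans grade_le)⟩

theorem idealGrade_eq_height_of_forall_idealGrade_eq_height [FaithfulSMul A B] (m : Ideal A)
    [hm : m.IsMaximal]
    (hgrade : ∀ M : Ideal B, M.IsMaximal → M.comap (algebraMap A B) = m →
      idealGrade B M X = M.height)
    (hheight : ∀ M N : Ideal B, M.IsMaximal → N.IsMaximal → M.comap (algebraMap A B) = m →
      N.comap (algebraMap A B) = m → M.height = N.height) :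
    idealGrade A m X = m.height := by
  have : IsNoetherianRing B := isNoetherian_of_tower A inferInstance
  have : Module.Finite A X := .trans B X
  have : FaithfulSMul A X := faithfulSMul_trans A B X
  refine (idealGrade_le_height m).antisymm (ENat.forall_natCast_le_iff_le.1 fun n hn ↦ ?_)
  obtain ⟨N, hN, hNm, hNheight⟩ := exists_isMaximal_comap_eq_and_height_eq (B := B) m
  refine natCast_le_idealGrade_of_forall_comap_eq (B := B)
    (smul_top_ne_top_of_finite hm.ne_top) fun M hM hMm ↦ ?_
  rwa [hgrade M hM hMm, hheight M N hM hN hMm hNm, hNheight]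

theorem isMaximalCohenMacaulayModule_iff_of_finite [FaithfulSMul A B] :
    IsMaximalCohenMacaulayModule A X ↔ IsMaximalCohenMacaulayModule B X ∧
      ∀ M N : Ideal B, M.IsMaximal → N.IsMaximal →
        M.comap (algebraMap A B) = N.comap (algebraMap A B) → M.height = N.height := by
  have : IsNoetherianRing B := isNoetherian_of_tower A inferInstance
  have : Module.Finite A X := .trans B X
  have : FaithfulSMul A X := faithfulSMul_trans A B X
  simp only [isMaximalCohenMacaulayModule_iff_forall_idealGrade_eq_height]
  constructor
  · intro hA
    have descend (M : Ideal B) [M.IsMaximal] :=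
      idealGrade_eq_height_of_idealGrade_comap_eq_height (X := X)
        (hA (M.comap (algebraMap A B)) (Ideal.isMaximal_comap_of_isIntegral_of_isMaximal M))
    exact ⟨fun M hM ↦ (descend M).1, fun M N hM hN hMN ↦ by rw [(descend M).2, (descend N).2, hMN]⟩
  · rintro ⟨hB, hheight⟩ m hm
    exact idealGrade_eq_height_of_forall_idealGrade_eq_height m (fun M hM _ ↦ hB M hM)
      fun M N hM hN hMm hNm ↦ hheight M N hM hN (hMm.trans hNm.symm)

end FiniteExtension

end CentrallyMacaulay

open CentrallyMacaulay in
theorem mainTheorem8_general {A B R : Type*} [CommRing A] [CommRing B] [Ring R] [Algebra A B]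
    [Algebra B R] [Algebra A R] [IsScalarTower A B R] [FaithfulSMul A B] [FaithfulSMul B R]
    [IsNoetherianRing R] [Module.Finite A R] :
    IsMacaulayOver A R ↔ IsMacaulayOver B R ∧
      ∀ M N : Ideal B, M.IsMaximal → N.IsMaximal →
        M.comap (algebraMap A B) = N.comap (algebraMap A B) → M.height = N.height := by
  have : IsNoetherian A R := isNoetherian_of_isNoetherian_of_finite R
  have : IsNoetherian A B :=
    isNoetherian_of_injective (IsScalarTower.toAlgHom A B R).toLinearMap
      (FaithfulSMul.algebraMap_injective B R)
  have : IsNoetherianRing A :=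
    isNoetherian_of_injective (Algebra.linearMap A B) (FaithfulSMul.algebraMap_injective A B)
  have : Module.Finite B R := .of_restrictScalars_finite A B R
  exact isMaximalCohenMacaulayModule_iff_of_finite

open CentrallyMacaulay in
/-- A central subring of `R` is given as a subring `C` of the centre `Z(R) = Subring.center R`;
the contraction of an ideal `M` of `Z(R)` to `C` is `M.comap C.subtype`. -/
theorem mainTheorem8 {R : Type*} [Ring R] [IsNoetherianRing R]
    (C : Subring (Subring.center R)) [Module.Finite C R] :
    (IsMacaulayOver (Subring.center R) R →
      (IsMacaulayOver C R ↔
        ∀ M N : Ideal (Subring.center R), M.IsMaximal → N.IsMaximal →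
          M.comap C.subtype = N.comap C.subtype → M.height = N.height)) ∧
    (IsEquicodimensional (Subring.center R) →
      (IsMacaulayOver (Subring.center R) R ↔ IsMacaulayOver C R)) := by
  have key := mainTheorem8_general (A := C) (B := Subring.center R) (R := R)
  exact ⟨fun hZ ↦ key.trans (and_iff_right hZ), fun hequi ↦
    ⟨fun hZ ↦ key.2 ⟨hZ, fun M N hM hN _ ↦ hequi M N hM hN⟩, fun hC ↦ (key.1 hC).1⟩⟩
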